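/- Let $N$ be a finite group all of whose Sylow subgroups are abelian. Then Gaschütz' theorem holds for $N$; that is, whenever $N$ is embedded as a normal subgroup in a finite group $G$ and $H$ is a subgroup with $N\le H\le G$ and $\gcd(|N|,|G:H|)=1$ such that $N$ has a complement in $H$, then $N$ has a complement in $G$. Here a complement of a normal subgroup $N$ in a group $G$ is a subgroup $K\le G$ with $G=NK$ and $N\cap K=1$. -/

import Mathlib

universe u v

/-- A subgroup `N` of `G` has a complement in the subgroup `H` (meant for `N ≤ H`): some
subgroup `K` of `H` satisfies `H = N K` and `N ∩ K = 1`. -/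
def HasComplementIn {G : Type*} [Group G] (N H : Subgroup G) : Prop :=
  ∃ K : Subgroup H, (N.subgroupOf H).IsComplement' K

/-- Gaschütz' theorem holds for the finite group `N`: for every finite group `G`, every embedding
of `N` into `G` with normal image, and every subgroup `H` of `G` containing this image, of index
prime to `|N|`, in which the image has a complement, the image has a complement in `G`.
The universe `v` of the groups `G` is arbitrary. -/
def GaschuetzTheoremHoldsFor (N : Type u) [Group N] : Prop :=
  ∀ (G : Type v) [Group G] [Finite G] (i : N →* G) (H : Subgroup G),
    Function.Injective i → i.range.Normal → i.range ≤ H →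
    Nat.Coprime (Nat.card N) H.index →
    HasComplementIn i.range H →
    ∃ K : Subgroup G, i.range.IsComplement' K

/-!
Let `N` be normal in `G` with all Sylow subgroups abelian. Say that `G` splits at `p` over `N` if
some `p`-subgroup `T` of `G` meets `N` trivially and maps onto a Sylow `p`-subgroup of `G ⧸ N`
(`SplitsAt`). If `N` has a complement `K` in a subgroup of index prime to `|N|`, a Sylow
`p`-subgroup of `K` shows that `G` splits at every prime divisor `p` of `|N|`. It remains to prove
a local-to-global principle, `exists_supplement_of_splitsAt`: if `G` splits over `N` at every prime
of a finite set `σ`, then there is a supplement `L` of `N` with `|L ∩ N|` prime to all of `σ`.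

The principle is proved by induction on `|N|` and then on `σ`. Suppose it is known for `σ` and let
`p` be a further prime. Let `L` be a minimal supplement with `|L ∩ N|` prime to `σ`; if `p` divides
`|L ∩ N|`, let `A` be a Sylow `p`-subgroup of `L ∩ N`. The Frattini argument and minimality make
`A` normal in `L` (`normalizer_sylow_of_minimal`), so the normalizer `Γ` of `A` supplements `N`.
Let `C` be the centralizer of `A` in `N` and `R` the subgroup generated by the `p'`-elements of
`C`. Since `C` contains a Sylow `p`-subgroup of `N`, which is abelian, `C ⧸ R` is an abelian
`p`-group, and since `G` splits at `p`, it is complemented in a Sylow `p`-subgroup of `Γ ⧸ R`.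
By the abelian case of Gaschütz' theorem (`exists_isComplement'_of_coprime_index_sup`) it is
complemented in `Γ ⧸ R`, which yields `Y ≤ Γ` of `p`-power index with `Y N = G` and `Y ∩ C = R`.
Transfer shows `A ∩ R = 1`, because `A` is central in `C`; hence `Y ∩ N` is smaller than `N`
(`exists_smaller_supplement`).

The induction applies to `Y` and `Y ∩ N` once `Y` is known to split at all primes of `σ ∪ {p}`.
For a prime `q` of `σ`, a Sylow `q`-subgroup of `L` meets `N` trivially and is conjugate in `Γ`
into `Y`, whose index is a power of `p`. At `p`, the group `Y ∩ N` has no nontrivial homomorphism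
to a `p`-group. By transfer, its Sylow `p`-subgroup `P` has no nontrivial element centralized by
the normalizer of `P` in `Y ∩ N`, and an averaging argument produces a complement of `P` in its
normalizer in `Y` (`exists_isComplement'_of_centralizer_eq_bot`,
`splitsAt_of_forall_hom_eq_one`).
-/

open Subgroup
open scoped IsMulCommutative

/-! ### Complements of abelian normal subgroups -/

/-- A crossed homomorphism `f : G → A` that restricts on `A` to the power map by an exponent prime to
`|A|` has a complement of `A` as its kernel. -/
theorem exists_isComplement'_of_crossedHom {G : Type*} [Group G] (A : Subgroup G) [A.Normal]
    [IsMulCommutative A] {n : ℕ} (hn : (Nat.card A).Coprime n) (f : G → A)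
    (hmul : ∀ g h, f (g * h) = f g * MulAut.conjNormal g (f h))
    (hpow : ∀ a : A, f a = a ^ n) : ∃ K : Subgroup G, A.IsComplement' K := by
  have h1 : f 1 = 1 := by simpa using hpow 1
  let K : Subgroup G :=
    { carrier := {g | f g = 1}
      one_mem' := h1
      mul_mem' := fun {a b} ha hb => by
        simp only [Set.mem_ofPred_eq] at *
        rw [hmul, ha, hb, map_one, mul_one]
      inv_mem' := fun {a} ha => by
        simp only [Set.mem_ofPred_eq] at *
        have := hmul a⁻¹ a
        rw [inv_mul_cancel, h1, ha, map_one, mul_one] at this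
        exact this.symm }
  refine ⟨K, isComplement'_of_disjoint_and_mul_eq_univ ?_ ?_⟩
  · rw [Subgroup.disjoint_def]
    intro x hx hxK
    have h : f x = 1 := hxK
    have h2 : (⟨x, hx⟩ : A) ^ n = 1 ^ n := by rw [← hpow ⟨x, hx⟩, one_pow]; exact h
    have h3 := (powCoprime hn).injective (a₁ := ⟨x, hx⟩) (a₂ := 1) h2
    exact congrArg Subtype.val h3
  · refine Set.eq_univ_of_forall fun g => ?_
    obtain ⟨a, ha⟩ := (powCoprime hn).surjective (f g)
    refine ⟨a, a.2, (a : G)⁻¹ * g, ?_, by simp⟩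
    change f _ = 1
    have ha' : a ^ n = f g := ha
    have h := hmul a ((a : G)⁻¹ * g)
    rw [mul_inv_cancel_left, hpow, ha'] at h
    have h2 : MulAut.conjNormal (a : G) (f ((a : G)⁻¹ * g)) = 1 := by
      simpa using h.symm
    simpa using h2

/-- Gaschütz' theorem for an abelian normal subgroup `A`: a complement `T` of `A` in a subgroup of
index prime to `|A|` gives a complement of `A` in the whole group. A choice of representatives of
the cosets of `A T` is compared with its translates modulo `T`, and the resulting elements of `A` are
multiplied together. -/
theorem exists_isComplement'_of_coprime_index_sup {G : Type*} [Group G] [Finite G]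
    (A T : Subgroup G) [A.Normal] [IsMulCommutative A] (hT : T ⊓ A = ⊥)
    (hn : (Nat.card A).Coprime (A ⊔ T).index) : ∃ K : Subgroup G, A.IsComplement' K := by
  classical
  set S := A ⊔ T with hS
  have : Fintype (G ⧸ S) := Fintype.ofFinite _
  have hTA : ∀ t ∈ T, t ∈ A → t = 1 := fun t h1 h2 => by
    have : t ∈ T ⊓ A := ⟨h1, h2⟩
    simpa [hT] using this
  -- The element `g * s (g⁻¹ r)`, for the section `s = Quotient.out`, lies in `a * s r * T` for a
  -- unique `a` in `A`, called `b g r` below.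
  have key : ∀ (g : G) (r : G ⧸ S), ∃ a : A,
      r.out⁻¹ * (a : G)⁻¹ * (g * (g⁻¹ • r).out) ∈ T := by
    intro g r
    have h : r.out⁻¹ * (g * (g⁻¹ • r).out) ∈ S := by
      rw [← QuotientGroup.eq]
      rw [QuotientGroup.out_eq', ← smul_eq_mul, ← MulAction.Quotient.smul_coe,
        QuotientGroup.out_eq', smul_inv_smul]
    obtain ⟨a, ha, t, ht, hat⟩ := Subgroup.mem_sup_of_normal_left.mp h
    refine ⟨⟨r.out * a * r.out⁻¹, Normal.conj_mem inferInstance a ha _⟩, ?_⟩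
    convert ht using 1
    rw [eq_mul_of_inv_mul_eq hat.symm]
    group
  choose b hb using key
  have huniq : ∀ (g : G) (r : G ⧸ S) (a : A),
      r.out⁻¹ * (a : G)⁻¹ * (g * (g⁻¹ • r).out) ∈ T → b g r = a := by
    intro g r a ha
    have h := mul_mem (hb g r) (inv_mem ha)
    have h2 := hTA _ h (by
      have : r.out⁻¹ * ((b g r : G)⁻¹ * a) * (r.out⁻¹)⁻¹ ∈ A :=
        Normal.conj_mem inferInstance _ (mul_mem (inv_mem (b g r).2) a.2) _
      convert this using 1
      group)
    have h3 : (b g r : G)⁻¹ * a = 1 := by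
      have : (b g r : G)⁻¹ * a = r.out * (r.out⁻¹ * (b g r : G)⁻¹ * (g * (g⁻¹ • r).out) *
        (r.out⁻¹ * (a : G)⁻¹ * (g * (g⁻¹ • r).out))⁻¹) * r.out⁻¹ := by group
      rw [this, h2]; group
    exact Subtype.ext (inv_mul_eq_one.mp h3)
  refine exists_isComplement'_of_crossedHom A hn (fun g => ∏ r, b g r) ?_ ?_
  · intro g h
    rw [map_prod, ← Equiv.prod_comp (MulAction.toPerm g⁻¹) (fun r => MulAut.conjNormal g (b h r)),
      ← Finset.prod_mul_distrib]
    refine Finset.prod_congr rfl fun r _ => huniq _ _ _ ?_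
    have h1 := mul_mem (hb g r) (hb h (g⁻¹ • r))
    convert h1 using 1
    rw [mul_comm (b g r)]
    simp only [mul_inv_rev, mul_smul, MulAction.toPerm_apply, coe_mul, MulAut.conjNormal_apply]
    group
  · intro a
    rw [index_eq_card, Nat.card_eq_fintype_card, ← Finset.card_univ, ← Finset.prod_const]
    refine Finset.prod_congr rfl fun r _ => huniq _ _ _ ?_
    have h : (a : G)⁻¹ • r = r := by
      obtain ⟨x, rfl⟩ := QuotientGroup.mk_surjective r
      rw [MulAction.Quotient.smul_coe, QuotientGroup.eq]
      refine Subgroup.mem_sup_left ?_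
      have := Normal.conj_mem (H := A) inferInstance a a.2 x⁻¹
      convert this using 1
      simp [mul_assoc]
    rw [h]
    convert one_mem T using 1
    group

/-- An abelian normal subgroup `A` is complemented in `G` if a normal subgroup `B` with `A.relIndex B`
prime to `|A|` centralizes no nontrivial element of `A`. A section of `B A / A` is compared with its
conjugates under `G`; on `A` this crossed homomorphism is a power map, because the norm of an element
of `A` over `B` is centralized by `B`. -/
theorem exists_isComplement'_of_centralizer_eq_bot {G : Type*} [Group G] [Finite G]
    (A B : Subgroup G) [A.Normal] [B.Normal] [IsMulCommutative A]
    (hn : (Nat.card A).Coprime (A.relIndex B))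
    (hC : ∀ a ∈ A, (∀ b ∈ B, b * a = a * b) → a = 1) : ∃ K : Subgroup G, A.IsComplement' K := by
  classical
  set π := QuotientGroup.mk' A with hπ
  have hπA : ∀ x, x ∈ A ↔ π x = 1 := fun x => (QuotientGroup.eq_one_iff x).symm
  set Q := B.map π with hQ
  have : Q.Normal := Normal.map inferInstance _ (QuotientGroup.mk'_surjective A)
  have : Fintype Q := Fintype.ofFinite _
  have hcard : Fintype.card Q = A.relIndex B := by
    rw [← Nat.card_eq_fintype_card, hQ, ← relIndex_ker, QuotientGroup.ker_mk']
  have hs : ∀ q : Q, ∃ b, π b = q := fun q => QuotientGroup.mk'_surjective A q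
  choose s hs using hs
  let c : G → Q ≃* Q := fun g => MulAut.conjNormal (π g)⁻¹
  have hc : ∀ g q, ((c g q : Q) : G ⧸ A) = (π g)⁻¹ * q * π g := fun g q => by
    simp [c]
  have hmem : ∀ g q, g * s (c g q) * g⁻¹ * (s q)⁻¹ ∈ A := fun g q => by
    rw [hπA]
    simp only [map_mul, map_inv, hs, hc]
    group
  have hc2 : ∀ g h q, c (g * h) q = c h (c g q) := fun g h q => by
    apply Subtype.ext
    simp only [hc, map_mul]
    group
  -- The conjugate by `g` of the section `s` takes the value `g * s (c g q) * g⁻¹` at `q`.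
  refine exists_isComplement'_of_crossedHom A hn (fun g => ∏ q, ⟨_, hmem g q⟩) ?_ ?_
  · intro g h
    rw [map_prod, ← Equiv.prod_comp (c g).toEquiv
      (fun q => MulAut.conjNormal g (⟨_, hmem h q⟩ : A)), ← Finset.prod_mul_distrib]
    refine Finset.prod_congr rfl fun q _ => ?_
    rw [mul_comm]
    apply Subtype.ext
    simp only [hc2, coe_mul, MulAut.conjNormal_apply, MulEquiv.toEquiv_eq_coe, EquivLike.coe_coe]
    group
  · intro a
    have hca : ∀ q, c a q = q := fun q => by
      apply Subtype.ext
      rw [hc, (hπA a).mp a.2]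
      simp
    -- The norm of `a` is fixed by `B`, hence trivial.
    have hprod : ∏ q : Q, MulAut.conjNormal (s q) a = 1 := by
      apply Subtype.ext
      refine hC _ (SetLike.coe_mem _) fun b hb => ?_
      suffices MulAut.conjNormal b (∏ q : Q, MulAut.conjNormal (s q) a) =
          ∏ q : Q, MulAut.conjNormal (s q) a by
        have h := congrArg Subtype.val this
        rw [MulAut.conjNormal_apply] at h
        exact mul_inv_eq_iff_eq_mul.mp h
      let e : Q ≃ Q := Equiv.mulLeft ⟨π b, b, hb, rfl⟩
      rw [map_prod, ← Equiv.prod_comp e (fun q => MulAut.conjNormal (s q) a)]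
      refine Finset.prod_congr rfl fun q _ => ?_
      have h1 : (s (e q))⁻¹ * (b * s q) ∈ A := by
        rw [hπA]
        simp [hs, e]
      have h2 := setLike_mul_comm h1 a.2
      apply Subtype.ext
      simp only [MulAut.conjNormal_apply]
      calc b * (s q * a * (s q)⁻¹) * b⁻¹
          = s (e q) * ((s (e q))⁻¹ * (b * s q) * a) * (s q)⁻¹ * b⁻¹ := by group
        _ = s (e q) * a * (s (e q))⁻¹ := by rw [h2]; group
    have hcalc : ∀ q : Q, (⟨_, hmem a q⟩ : A) = a * (MulAut.conjNormal (s q) a)⁻¹ := fun q => by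
      apply Subtype.ext
      simp only [hca, coe_mul, coe_inv, MulAut.conjNormal_apply]
      group
    rw [Finset.prod_congr rfl fun q _ => hcalc q, Finset.prod_mul_distrib, Finset.prod_const,
      Finset.prod_inv_distrib, hprod, Finset.card_univ, hcard]
    simp

/-! ### Transfer into an abelian Sylow subgroup -/

/-- If a nontrivial element `x` of the abelian Sylow subgroup `P` is centralized by the normalizer of
`P`, then the transfer into `P` does not kill `x`: by Burnside's fusion lemma a power of `x` has no
other conjugate in `P`, so that the transfer raises `x` to the power `P.index`. -/
theorem Sylow.exists_hom_ne_one {M : Type*} [Group M] [Finite M] {p : ℕ} [Fact p.Prime]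
    (P : Sylow p M) [IsMulCommutative P] {x : M} (hx : x ∈ P) (hx1 : x ≠ 1)
    (hc : ∀ m ∈ normalizer (P : Set M), x * m = m * x) : ∃ φ : M →* P, φ x ≠ 1 := by
  refine ⟨MonoidHom.transfer (MonoidHom.id P), ?_⟩
  have key : ∀ (k : ℕ) (g : M), g⁻¹ * x ^ k * g ∈ (P : Subgroup M) → g⁻¹ * x ^ k * g = x ^ k := by
    intro k g h
    obtain ⟨n, hn, h⟩ := P.conj_eq_normalizer_conj_of_mem (x ^ k) g (pow_mem hx k) h
    rw [h, mul_assoc, (Commute.pow_left (hc n hn) k).eq, inv_mul_cancel_left]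
  rw [MonoidHom.transfer_eq_pow _ x key]
  intro h
  have h1 : x ^ (P : Subgroup M).index = 1 := congrArg Subtype.val h
  have h2 : ¬ p ∣ (P : Subgroup M).index := P.not_dvd_index
  obtain ⟨k, hk⟩ := (IsPGroup.iff_orderOf.mp P.isPGroup') ⟨x, hx⟩
  rw [Subgroup.orderOf_mk] at hk
  have h3 := orderOf_dvd_of_pow_eq_one h1
  rw [hk] at h3
  rcases k with _ | k
  · exact hx1 (orderOf_eq_one_iff.mp (by simpa using hk))
  · exact h2 ((dvd_pow_self p (Nat.succ_ne_zero k)).trans h3)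

/-! ### Splitting at a prime -/

/-- All Sylow subgroups of the group `N` are abelian, expressed through the `p`-subgroups of the ambient
group that lie in `N`, so that the property passes to subgroups. -/
def HasAbelianSylows {G : Type*} [Group G] (N : Subgroup G) : Prop :=
  ∀ p : ℕ, p.Prime → ∀ Q : Subgroup G, Q ≤ N → IsPGroup p Q → IsMulCommutative Q

/-- The group `G` splits at `p` over `N` (meant for `N` normal): some `p`-subgroup `T` meets `N`
trivially and `T N / N` has index prime to `p` in `G / N`. -/
def SplitsAt {G : Type*} [Group G] (p : ℕ) (N : Subgroup G) : Prop :=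
  ∃ T : Subgroup G, IsPGroup p T ∧ T ⊓ N = ⊥ ∧ ¬ p ∣ (T ⊔ N).index

/-- The subgroup generated by the elements of `N` of order prime to `p`; for finite `N` this is
`O^p(N)`. -/
def primeToClosure {G : Type*} [Group G] (p : ℕ) (N : Subgroup G) : Subgroup G :=
  closure {x | x ∈ N ∧ p.Coprime (orderOf x)}

section

variable {G : Type*} [Group G]

theorem HasAbelianSylows.subgroupOf {N : Subgroup G} (h : HasAbelianSylows N) (H : Subgroup G) :
    HasAbelianSylows (N.subgroupOf H) := by
  intro p hp Q hQ hQp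
  have h1 := h p hp (Q.map H.subtype) (by
    rw [map_le_iff_le_comap]; exact hQ) (hQp.map _)
  refine .of_setLike_mul_comm fun a ha b hb => ?_
  have := setLike_mul_comm (mem_map_of_mem H.subtype ha) (mem_map_of_mem H.subtype hb)
  exact Subtype.ext this

theorem HasAbelianSylows.isMulCommutative {N : Subgroup G} (h : HasAbelianSylows N) {p : ℕ}
    (hp : p.Prime) (P : Sylow p N) : IsMulCommutative P := by
  have h1 := h p hp ((P : Subgroup N).map N.subtype) (map_subtype_le _) (P.2.map _)
  refine .of_setLike_mul_comm fun a ha b hb => ?_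
  have := setLike_mul_comm (mem_map_of_mem N.subtype ha) (mem_map_of_mem N.subtype hb)
  exact Subtype.ext this

theorem eq_bot_of_isPGroup_of_not_dvd {p : ℕ} [Fact p.Prime] [Finite G] {Q K : Subgroup G}
    (hQ : IsPGroup p Q) (hQK : Q ≤ K) (h : ¬ p ∣ Nat.card K) : Q = ⊥ := by
  obtain ⟨k, hk⟩ := IsPGroup.iff_card.mp hQ
  rcases k with _ | k
  · exact card_eq_one.mp (by simpa using hk)
  · exact absurd (((dvd_pow_self p (Nat.succ_ne_zero k)).trans hk.symm.dvd).trans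
      (card_dvd_of_le hQK)) h

theorem index_sup_mul_relIndex (T N : Subgroup G) [N.Normal] :
    (T ⊔ N).index * N.relIndex T = N.index := by
  rw [← relIndex_sup_right T N, mul_comm, relIndex_mul_index le_sup_right]

theorem relIndex_dvd_relIndex_of_normal (A : Subgroup G) [A.Normal] {X Z : Subgroup G}
    (h : X ≤ Z) : A.relIndex X ∣ A.relIndex Z := by
  have h1 := relIndex_ker (K := X) (QuotientGroup.mk' A)
  have h2 := relIndex_ker (K := Z) (QuotientGroup.mk' A)
  rw [QuotientGroup.ker_mk'] at h1 h2
  rw [h1, h2]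
  exact card_dvd_of_le (map_mono h)

theorem relIndex_eq_card_of_inf_eq_bot {T N : Subgroup G} (h : T ⊓ N = ⊥) :
    N.relIndex T = Nat.card T := by
  rw [← inf_relIndex_left, h, relIndex_bot_left]

/-- A Sylow `p`-subgroup of `W` witnesses the splitting. -/
theorem splitsAt_of_subgroup [Finite G] {p : ℕ} [Fact p.Prime] (N W : Subgroup G) [N.Normal]
    (h1 : ¬ p ∣ Nat.card (W ⊓ N : Subgroup G)) (h2 : ¬ p ∣ (W ⊔ N).index) : SplitsAt p N := by
  obtain ⟨S⟩ : Nonempty (Sylow p W) := inferInstance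
  set T := (S : Subgroup W).map W.subtype with hT
  have hTW : T ≤ W := map_subtype_le _
  have hTp : IsPGroup p T := S.2.map _
  have hTN : T ⊓ N = ⊥ :=
    eq_bot_of_isPGroup_of_not_dvd (hTp.to_le inf_le_left) (inf_le_inf_right N hTW) h1
  refine ⟨T, hTp, hTN, fun h => ?_⟩
  have e1 := index_sup_mul_relIndex T N
  have e2 := index_sup_mul_relIndex W N
  have e3 : N.relIndex W * Nat.card (W ⊓ N : Subgroup G) = Nat.card W := by
    rw [← inf_relIndex_left W N, ← relIndex_bot_left, ← relIndex_bot_left, mul_comm,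
      relIndex_mul_relIndex _ _ _ bot_le inf_le_left]
  have e4 : Nat.card T * (S : Subgroup W).index = Nat.card W := by
    rw [hT, card_map_of_injective W.subtype_injective, card_mul_index]
  rw [relIndex_eq_card_of_inf_eq_bot hTN] at e1
  have e5 : (T ⊔ N).index * Nat.card (W ⊓ N : Subgroup G) =
      (W ⊔ N).index * (S : Subgroup W).index := by
    refine Nat.eq_of_mul_eq_mul_left (Nat.card_pos (α := T)) ?_
    linear_combination Nat.card (W ⊓ N : Subgroup G) * (e1 - e2) + (W ⊔ N).index * (e3 - e4)
  exact (Fact.out : p.Prime).prime.not_dvd_mul h2 S.not_dvd_index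
    (e5 ▸ h.mul_right _)

/-- Splitting at `p` passes to a supplement `H` of `N` whose index is prime to `p`: a conjugate of the
witness lies in `H`. -/
theorem SplitsAt.subgroupOf [Finite G] {p : ℕ} [Fact p.Prime] {N H : Subgroup G} [N.Normal]
    (hN : SplitsAt p N) (hH : H ⊔ N = ⊤) (hp : ¬ p ∣ H.index) : SplitsAt p (N.subgroupOf H) := by
  obtain ⟨T, hTp, hTN, hTi⟩ := hN
  obtain ⟨S, hTS⟩ := hTp.exists_le_sylow
  obtain ⟨P⟩ : Nonempty (Sylow p H) := inferInstance
  let P' : Subgroup G := (P : Subgroup H).map H.subtype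
  have hP' : ¬ p ∣ P'.index := by
    rw [index_map_subtype]
    exact (Fact.out : p.Prime).prime.not_dvd_mul P.not_dvd_index hp
  let P'' : Sylow p G := (P.2.map H.subtype : IsPGroup p P').toSylow hP'
  obtain ⟨g, hg⟩ := MulAction.exists_smul_eq G S P''
  set T' := T.map (MulAut.conj g).toMonoidHom with hT'
  have hT'H : T' ≤ H := by
    have h1 : T' ≤ P' := by
      have : (P'' : Subgroup G) = (S : Subgroup G).map (MulAut.conj g).toMonoidHom := by
        rw [← hg]; rfl
      change T' ≤ (P'' : Subgroup G)
      rw [this]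
      exact map_mono hTS
    exact h1.trans (map_subtype_le _)
  have hNg : N.map (MulAut.conj g).toMonoidHom = N := Normal.map_conj_eq N g
  have hT'N : T' ⊓ N = ⊥ := by
    conv_lhs => rw [← hNg, hT', ← map_inf _ _ _ (MulAut.conj g).injective, hTN, Subgroup.map_bot]
  have hcard : Nat.card T' = Nat.card T := card_map_of_injective (MulAut.conj g).injective
  have hbot : T'.subgroupOf H ⊓ N.subgroupOf H = ⊥ := by
    exact (comap_inf T' N H.subtype).symm.trans (by rw [hT'N]; exact bot_subgroupOf H)
  refine ⟨T'.subgroupOf H, (hTp.map _).comap_subtype, hbot, fun h => hTi ?_⟩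
  have e1 := index_sup_mul_relIndex T N
  have e2 := index_sup_mul_relIndex (T'.subgroupOf H) (N.subgroupOf H)
  have e3 : (N.subgroupOf H).index = N.index := by
    change N.relIndex H = _
    rw [← relIndex_sup_right H N, hH, relIndex_top_right]
  have e4 : Nat.card (T'.subgroupOf H) = Nat.card T' :=
    Nat.card_congr (subgroupOfEquivOfLe hT'H).toEquiv
  rw [relIndex_eq_card_of_inf_eq_bot hTN] at e1
  rw [relIndex_eq_card_of_inf_eq_bot hbot, e3, e4, hcard, ← e1] at e2
  rwa [Nat.eq_of_mul_eq_mul_right Nat.card_pos e2] at h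

/-- If `N` has no nontrivial homomorphism to its Sylow `p`-subgroup `P`, then by transfer no nontrivial
element of `P` is centralized by the normalizer of `P` in `N`. Hence `P` has a complement in its
normalizer in `G`, and this complement supplements `N` with intersection of order prime to `p`. -/
theorem splitsAt_of_forall_hom_eq_one [Finite G] {p : ℕ} [hp : Fact p.Prime] (N : Subgroup G)
    [N.Normal] (hab : HasAbelianSylows N)
    (hno : ∀ (P : Sylow p N) (φ : N →* P) (x : N), φ x = 1) : SplitsAt p N := by
  obtain ⟨P⟩ : Nonempty (Sylow p N) := inferInstance
  have := hab.isMulCommutative hp.out P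
  set P' : Subgroup G := (P : Subgroup N).map N.subtype with hP'
  have hP'N : P' ≤ N := map_subtype_le _
  set J := normalizer (P' : Set G) with hJ
  have hJN : J ⊔ N = ⊤ := P.normalizer_sup_eq_top
  have hP'J : P' ≤ J := le_normalizer
  set A := P'.subgroupOf J with hA
  set B := N.subgroupOf J with hB
  have hAn : A.Normal := normal_in_normalizer
  have hAp : IsPGroup p A := (P.2.map _).comap_subtype
  have : IsMulCommutative P' := map_isMulCommutative _ _
  have hAc : IsMulCommutative A := subgroupOf_isMulCommutative _ _
  have hind : ¬ p ∣ A.relIndex B := by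
    have h1 : A.relIndex B ∣ P'.relIndex N := by
      rw [← relIndex_map_map_of_injective A B J.subtype_injective, hA, hB, subgroupOf_map_subtype,
        subgroupOf_map_subtype, inf_of_le_left hP'J,
        ← relIndex_mul_relIndex _ _ _ (le_inf hP'N hP'J) inf_le_left]
      exact dvd_mul_right _ _
    have h2 : P'.relIndex N = (P : Subgroup N).index := by
      rw [relIndex, hP', subgroupOf, comap_map_eq_self_of_injective N.subtype_injective]
    exact fun h => P.not_dvd_index (h2 ▸ h.trans h1)
  obtain ⟨k, hk⟩ := IsPGroup.iff_card.mp hAp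
  obtain ⟨K, hK⟩ := exists_isComplement'_of_centralizer_eq_bot A B
    (by rw [hk]; exact Nat.Coprime.pow_left _ ((Nat.Prime.coprime_iff_not_dvd hp.out).mpr hind))
    (by
      intro a ha hcomm
      obtain ⟨x, hxP, hxa⟩ : ∃ x ∈ (P : Subgroup N), (x : G) = a := ha
      by_contra ha1
      have hx1 : x ≠ 1 := fun h => ha1 (Subtype.ext (by rw [← hxa, h]; rfl))
      obtain ⟨φ, hφ⟩ := P.exists_hom_ne_one hxP hx1 fun m hm => by
        have hmJ : (m : G) ∈ J := by
          rw [hJ, hP']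
          exact le_normalizer_map N.subtype (mem_map_of_mem N.subtype hm)
        have h := congrArg Subtype.val (hcomm ⟨m, hmJ⟩ m.2)
        apply Subtype.ext
        simpa [hxa] using h.symm
      exact hφ (hno P φ x))
  have hKA : K ⊓ A = ⊥ := by rw [inf_comm]; exact hK.disjoint.eq_bot
  refine splitsAt_of_subgroup N (K.map J.subtype) ?_ ?_
  · have h1 : K.map J.subtype ⊓ N = (K ⊓ B).map J.subtype := by
      rw [hB, map_inf _ _ _ J.subtype_injective, subgroupOf_map_subtype, inf_comm N J, ← inf_assoc,
        inf_of_le_left (map_subtype_le K)]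
    rw [h1, card_map_of_injective J.subtype_injective, ← relIndex_eq_card_of_inf_eq_bot
      (N := A) (by rw [inf_right_comm, hKA, bot_inf_eq])]
    exact fun h => hind (h.trans (relIndex_dvd_relIndex_of_normal A inf_le_right))
  · have h1 : K.map J.subtype ⊔ P' = J := by
      have := congrArg (map J.subtype) hK.sup_eq_top
      rw [Subgroup.map_sup, hA, subgroupOf_map_subtype, inf_of_le_left hP'J, ← MonoidHom.range_eq_map,
        range_subtype, sup_comm] at this
      exact this
    have h2 : K.map J.subtype ⊔ N = ⊤ := by
      rw [eq_top_iff, ← hJN]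
      exact sup_le (h1.ge.trans (sup_le_sup_left hP'N _)) le_sup_right
    rw [h2, index_top]
    exact hp.out.not_dvd_one

end

/-! ### Reduction to a smaller normal subgroup -/

section

variable {G : Type*} [Group G]

theorem primeToClosure_le (p : ℕ) (N : Subgroup G) : primeToClosure p N ≤ N :=
  (closure_le _).mpr fun _ hx => hx.1

instance primeToClosure_normal (p : ℕ) (N : Subgroup G) [N.Normal] :
    (primeToClosure p N).Normal := by
  refine ⟨fun x hx g => ?_⟩
  suffices primeToClosure p N ≤ (primeToClosure p N).comap (MulAut.conj g).toMonoidHom from this hx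
  refine (closure_le _).mpr fun y hy => subset_closure ⟨?_, ?_⟩
  · exact Normal.conj_mem inferInstance y hy.1 g
  · have : orderOf (MulAut.conj g y) = orderOf y := (MulAut.conj g).orderOf_eq y
    exact this.symm ▸ hy.2

theorem exists_pow_mem_primeToClosure [Finite G] {p : ℕ} (hp : p.Prime) {N : Subgroup G} {x : G}
    (hx : x ∈ N) : ∃ k : ℕ, x ^ p ^ k ∈ primeToClosure p N := by
  obtain ⟨k, m, hm, h⟩ := Nat.exists_eq_pow_mul_and_not_dvd (orderOf_pos x).ne' p hp.ne_one
  refine ⟨k, subset_closure ⟨pow_mem hx _, ?_⟩⟩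
  rw [orderOf_pow_of_dvd (pow_pos hp.pos k).ne' (h ▸ dvd_mul_right _ _), h,
    Nat.mul_div_cancel_left _ (pow_pos hp.pos k)]
  exact (Nat.Prime.coprime_iff_not_dvd hp).mpr hm

theorem IsPGroup.hom_eq_one {p : ℕ} {M Q : Type*} [Group M] [Group Q]
    (hQ : IsPGroup p Q) (φ : M →* Q) {x : M} {m : ℕ} (hm : p.Coprime m) (hx : φ x ^ m = 1) :
    φ x = 1 := by
  obtain ⟨k, hk⟩ := hQ (φ x)
  have h1 : orderOf (φ x) ∣ Nat.gcd (p ^ k) m :=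
    Nat.dvd_gcd (orderOf_dvd_of_pow_eq_one hk) (orderOf_dvd_of_pow_eq_one hx)
  rw [Nat.Coprime.pow_left k hm] at h1
  exact orderOf_eq_one_iff.mp (Nat.dvd_one.mp h1)

theorem hom_eq_one_of_mem_primeToClosure {p : ℕ} {N : Subgroup G} {M Q : Type*} [Group M]
    [Group Q] {f : M →* G} (hf : Function.Injective f) (hM : primeToClosure p N ≤ f.range)
    (hQ : IsPGroup p Q) (φ : M →* Q) {x : M} (hx : f x ∈ primeToClosure p N) : φ x = 1 := by
  suffices primeToClosure p N ≤ φ.ker.map f by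
    obtain ⟨y, hy, hyx⟩ := this hx
    rw [← hf hyx]
    exact hy
  refine (closure_le _).mpr fun y hy => ?_
  obtain ⟨z, rfl⟩ := hM (subset_closure hy)
  have hz : orderOf (f z) = orderOf z := orderOf_injective f hf z
  refine ⟨z, hQ.hom_eq_one φ (hz ▸ hy.2) ?_, rfl⟩
  rw [← map_pow, pow_orderOf_eq_one, map_one]

/-- Gaschütz' theorem for `N / R` in `G / R`, when this is a `p`-group. The `p`-subgroups of `N` are
abelian, and one of them maps onto `N / R`, which is therefore abelian. -/
theorem exists_supplement_of_relIndex [Finite G] {p : ℕ} [hp : Fact p.Prime]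
    (R N T : Subgroup G) [R.Normal] [N.Normal] (hRN : R ≤ N)
    (hpow : ∀ x ∈ N, ∃ k : ℕ, x ^ p ^ k ∈ R)
    (hcomm : ∀ Q : Subgroup G, Q ≤ N → IsPGroup p Q → IsMulCommutative Q)
    (hT : T ⊓ N = ⊥) (hi : ¬ p ∣ (T ⊔ N).index) :
    ∃ Y : Subgroup G, Y ⊔ N = ⊤ ∧ Y ⊓ N = R ∧ ∃ k, Y.index = p ^ k := by
  set π := QuotientGroup.mk' R with hπ
  have hπs : Function.Surjective π := QuotientGroup.mk'_surjective R
  have hker : π.ker = R := QuotientGroup.ker_mk' R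
  set A := N.map π with hA
  have : A.Normal := Normal.map inferInstance _ hπs
  have hAp : IsPGroup p A := by
    rintro ⟨_, x, hx, rfl⟩
    obtain ⟨k, hk⟩ := hpow x hx
    refine ⟨k, Subtype.ext ?_⟩
    rw [← hker] at hk
    simpa using hk
  obtain ⟨k, hk⟩ := IsPGroup.iff_card.mp hAp
  have hAc : IsMulCommutative A := by
    obtain ⟨P⟩ : Nonempty (Sylow p N) := inferInstance
    set P' := (P : Subgroup N).map N.subtype with hP'
    have hP'N : P' ≤ N := map_subtype_le _
    have := hcomm P' hP'N (P.2.map _)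
    suffices A = P'.map π by rw [this]; infer_instance
    refine le_antisymm ?_ (map_mono hP'N)
    rw [← relIndex_eq_one]
    have h1 : (P'.map π).relIndex A ∣ p ^ k := hk ▸ relIndex_dvd_card _ _
    have h2 : (P'.map π).relIndex A ∣ P'.relIndex N := by
      rw [hA, relIndex_map_map, hker]
      rw [sup_of_le_left hRN]
      exact relIndex_dvd_of_le_left _ le_sup_left
    have h3 : P'.relIndex N = (P : Subgroup N).index := by
      rw [relIndex, hP', Subgroup.subgroupOf, comap_map_eq_self_of_injective N.subtype_injective]
    have h4 : Nat.Coprime (p ^ k) (P : Subgroup N).index :=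
      Nat.Coprime.pow_left _ ((Nat.Prime.coprime_iff_not_dvd hp.out).mpr P.not_dvd_index)
    exact Nat.eq_one_of_dvd_coprimes h4 h1 (h3 ▸ h2)
  have hTA : T.map π ⊓ A = ⊥ := by
    rw [eq_bot_iff]
    rintro _ ⟨⟨t, ht, rfl⟩, n, hn, hnt⟩
    have h1 : n⁻¹ * t ∈ R := by
      rw [← hker, MonoidHom.mem_ker, map_mul, map_inv, hnt, inv_mul_cancel]
    have h2 : t ∈ T ⊓ N := ⟨ht, by simpa using mul_mem hn (hRN h1)⟩
    rw [hT, mem_bot] at h2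
    rw [h2, map_one]
    exact one_mem _
  obtain ⟨K, hK⟩ := exists_isComplement'_of_coprime_index_sup A (T.map π) hTA (by
    rw [hk, hA, ← Subgroup.map_sup, sup_comm]
    exact Nat.Coprime.pow_left _ ((Nat.Prime.coprime_iff_not_dvd hp.out).mpr
      fun h => hi (h.trans (index_map_dvd _ hπs))))
  refine ⟨K.comap π, ?_, ?_, k, ?_⟩
  · rw [eq_top_iff]
    intro g _
    have : π g ∈ A ⊔ K := by rw [hK.sup_eq_top]; trivial
    obtain ⟨_, ⟨n, hn, rfl⟩, c, hc, h⟩ := Subgroup.mem_sup_of_normal_left.mp this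
    have h1 : n⁻¹ * g ∈ K.comap π := by
      rw [mem_comap, map_mul, map_inv, ← h, inv_mul_cancel_left]
      exact hc
    rw [← mul_inv_cancel_left n g]
    exact mul_mem (mem_sup_right hn) (mem_sup_left h1)
  · refine le_antisymm ?_ (le_inf ?_ hRN)
    · rintro x ⟨hx, hxN⟩
      rw [← hker]
      exact (Subgroup.disjoint_def.mp hK.disjoint) (mem_map_of_mem π hxN) hx
    · exact hker.ge.trans (ker_le_comap _ _)
  · rw [index_comap_of_surjective _ hπs, ← hk]
    exact hK.index_eq_card

/-- If `N` contains a nontrivial normal `p`-subgroup `A` of `G` and `G` splits at `p` over `N`, then some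
supplement `Y` of `N` of `p`-power index omits part of `A` and still splits at `p` over `Y ∩ N`. -/
theorem exists_smaller_supplement [Finite G] {p : ℕ} [hp : Fact p.Prime] (N A : Subgroup G)
    [N.Normal] [A.Normal] (hab : HasAbelianSylows N) (hA : IsPGroup p A) (hAN : A ≤ N)
    (hA1 : A ≠ ⊥) (hN : SplitsAt p N) :
    ∃ Y : Subgroup G, Y ⊔ N = ⊤ ∧ (∃ k, Y.index = p ^ k) ∧ ¬ A ≤ Y ∧
      SplitsAt p (N.subgroupOf Y) := by
  obtain ⟨T, hTp, hTN, hTi⟩ := hN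
  have hAc := hab p hp.out A hAN hA
  set C := centralizer (A : Set G) ⊓ N with hC
  have hCN : C ≤ N := inf_le_right
  have hAC : A ≤ C := le_inf (le_centralizer A) hAN
  -- Every Sylow `p`-subgroup of `N` contains `A` and is abelian, so it lies in `C`.
  have hCi : ¬ p ∣ C.relIndex N := by
    obtain ⟨P⟩ : Nonempty (Sylow p N) := inferInstance
    have := hab.isMulCommutative hp.out P
    have hAP : A.subgroupOf N ≤ P := (hA.comap_subtype (K := N)).le_sylow_of_normal P
    have hPC : (P : Subgroup N) ≤ C.subgroupOf N := by
      intro x hx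
      refine ⟨mem_centralizer_iff.mpr fun a ha => ?_, x.2⟩
      exact congrArg Subtype.val
        (setLike_mul_comm (s := (P : Subgroup N)) (a := ⟨a, hAN ha⟩) (b := x) (hAP ha) hx)
    exact fun h => P.not_dvd_index (h.trans (index_dvd_of_le hPC))
  have hTC : T ⊓ C = ⊥ := le_bot_iff.mp (hTN ▸ inf_le_inf_left T hCN)
  have hTCi : ¬ p ∣ (T ⊔ C).index := by
    have e1 := index_sup_mul_relIndex T N
    have e2 := index_sup_mul_relIndex T C
    have e3 := relIndex_mul_index hCN
    rw [relIndex_eq_card_of_inf_eq_bot hTN] at e1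
    rw [relIndex_eq_card_of_inf_eq_bot hTC, ← e3, ← e1, ← mul_assoc] at e2
    rw [Nat.eq_of_mul_eq_mul_right Nat.card_pos e2]
    exact hp.out.prime.not_dvd_mul hCi hTi
  set R := primeToClosure p C with hR
  obtain ⟨Y, hYC, hYR, k, hk⟩ := exists_supplement_of_relIndex R C T (primeToClosure_le p C)
    (fun x hx => exists_pow_mem_primeToClosure hp.out hx)
    (fun Q hQ => hab p hp.out Q (hQ.trans hCN)) hTC hTCi
  have hRY : R ≤ Y := hYR ▸ inf_le_left
  refine ⟨Y, ?_, ⟨k, hk⟩, ?_, ?_⟩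
  · exact top_le_iff.mp (hYC ▸ sup_le_sup_left hCN Y)
  · intro hAY
    -- Otherwise `A ≤ R`; but homomorphisms from `C` to a `p`-group kill `R`, while the transfer is
    -- nontrivial on `A`, which is central in `C`.
    have hAR : A ≤ R := hYR ▸ le_inf hAY hAC
    obtain ⟨a, haA, ha1⟩ := A.bot_or_exists_ne_one.resolve_left hA1
    obtain ⟨P⟩ : Nonempty (Sylow p C) := inferInstance
    have hPc : IsMulCommutative P :=
      HasAbelianSylows.isMulCommutative (fun q hq Q hQ => hab q hq Q (hQ.trans hCN)) hp.out P
    have hAP : A.subgroupOf C ≤ P := (hA.comap_subtype (K := C)).le_sylow_of_normal P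
    obtain ⟨φ, hφ⟩ := P.exists_hom_ne_one (x := ⟨a, hAC haA⟩) (hAP haA)
      (fun h => ha1 (congrArg Subtype.val h))
      (fun m _ => Subtype.ext (mem_centralizer_iff.mp m.2.1 a haA))
    exact hφ (hom_eq_one_of_mem_primeToClosure C.subtype_injective
      (C.range_subtype.symm ▸ primeToClosure_le p C) P.2 φ (hAR haA))
  · refine splitsAt_of_forall_hom_eq_one _ (hab.subgroupOf Y) fun P φ x => ?_
    have hφR : ∀ y : N.subgroupOf Y, ((y : Y) : G) ∈ R → φ y = 1 := by
      intro y hy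
      refine hom_eq_one_of_mem_primeToClosure (f := Y.subtype.comp (N.subgroupOf Y).subtype)
        (Y.subtype_injective.comp (N.subgroupOf Y).subtype_injective) (fun z hz => ?_) P.2 φ hy
      exact ⟨⟨⟨z, hRY hz⟩, hCN (primeToClosure_le p C hz)⟩, rfl⟩
    -- The quotient of `Y ∩ N` by `R = Y ∩ C` has exponent dividing the index of `C` in `N`, which is
    -- prime to `p`.
    refine P.2.hom_eq_one φ (m := C.relIndex N) ((Nat.Prime.coprime_iff_not_dvd hp.out).mpr hCi) ?_
    rw [← map_pow]
    refine hφR _ ?_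
    rw [← hYR]
    refine ⟨SetLike.coe_mem _, ?_⟩
    exact (C.subgroupOf N).pow_index_mem (⟨((x : Y) : G), x.2⟩ : N)

end

/-! ### From local splittings to a supplement -/

theorem Subgroup.map_subtype_sup_eq_top_of_subgroupOf {G : Type*} [Group G] {H N : Subgroup G}
    (hH : H ⊔ N = ⊤) {L : Subgroup H} (hL : L ⊔ N.subgroupOf H = ⊤) :
    L.map H.subtype ⊔ N = ⊤ := by
  rw [eq_top_iff, ← hH]
  refine sup_le ?_ le_sup_right
  have h := congrArg (map H.subtype) hL
  rw [Subgroup.map_sup, subgroupOf_map_subtype, ← MonoidHom.range_eq_map, range_subtype] at h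
  exact h.ge.trans (sup_le_sup_left inf_le_left _)

theorem Subgroup.card_map_subtype_inf {G : Type*} [Group G] (H N : Subgroup G) (L : Subgroup H) :
    Nat.card (L.map H.subtype ⊓ N : Subgroup G) = Nat.card (L ⊓ N.subgroupOf H : Subgroup H) := by
  rw [← card_map_of_injective (K := L ⊓ N.subgroupOf H) H.subtype_injective,
    map_inf _ _ _ H.subtype_injective, subgroupOf_map_subtype, inf_comm N H, ← inf_assoc,
    inf_of_le_left (map_subtype_le L)]

theorem Subgroup.subgroupOf_sup_eq_top {G : Type*} [Group G] {L H N : Subgroup G} [N.Normal]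
    (hL : L ⊔ N = ⊤) (hLH : L ≤ H) : L.subgroupOf H ⊔ N.subgroupOf H = ⊤ := by
  rw [eq_top_iff]
  intro h _
  have h1 : (h : G) ∈ L ⊔ N := by rw [hL]; trivial
  obtain ⟨l, hl, n, hn, e⟩ := Subgroup.mem_sup_of_normal_right.mp h1
  have hn' : n ∈ H := by
    rw [← inv_mul_cancel_left l n, e]
    exact mul_mem (inv_mem (hLH hl)) h.2
  have : h = ⟨l, hLH hl⟩ * ⟨n, hn'⟩ := Subtype.ext e.symm
  rw [this]
  exact mul_mem (mem_sup_left hl) (mem_sup_right hn)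

/-- For a minimal supplement `L` of `N`, the Frattini argument makes a Sylow `p`-subgroup of `L ∩ N`
normal in `L`. -/
theorem normalizer_sylow_of_minimal {G : Type*} [Group G] [Finite G] {p : ℕ} [hp : Fact p.Prime]
    {N L : Subgroup G} [N.Normal] (hL : L ⊔ N = ⊤) (hmin : ∀ L' ≤ L, L' ⊔ N = ⊤ → L' = L)
    (hpL : p ∣ Nat.card (L ⊓ N : Subgroup G)) :
    ∃ A : Subgroup G, IsPGroup p A ∧ A ≤ N ∧ A ≠ ⊥ ∧ L ≤ normalizer (A : Set G) := by
  obtain ⟨Q⟩ : Nonempty (Sylow p (N.subgroupOf L)) := inferInstance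
  set B : Subgroup L := (Q : Subgroup (N.subgroupOf L)).map (N.subgroupOf L).subtype with hB
  have hBN : B ≤ N.subgroupOf L := map_subtype_le _
  have hcard : Nat.card (N.subgroupOf L) = Nat.card (L ⊓ N : Subgroup G) := by
    rw [← card_map_of_injective (K := N.subgroupOf L) L.subtype_injective, subgroupOf_map_subtype,
      inf_comm]
  have hJ := hmin ((normalizer (B : Set L)).map L.subtype) (map_subtype_le _)
    (map_subtype_sup_eq_top_of_subgroupOf hL Q.normalizer_sup_eq_top)
  have hJtop : normalizer (B : Set L) = ⊤ := by
    refine map_injective L.subtype_injective ?_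
    rw [hJ, ← MonoidHom.range_eq_map, range_subtype]
  refine ⟨B.map L.subtype, (Q.2.map _).map _, ?_, ?_, ?_⟩
  · exact (map_mono hBN).trans (by rw [subgroupOf_map_subtype]; exact inf_le_left)
  · intro h
    have h1 : B = ⊥ := (map_eq_bot_iff_of_injective _ L.subtype_injective).mp h
    have h2 : (Q : Subgroup (N.subgroupOf L)) = ⊥ :=
      (map_eq_bot_iff_of_injective _ (N.subgroupOf L).subtype_injective).mp h1
    have h3 := Q.not_dvd_index
    rw [h2, index_bot, hcard] at h3
    exact h3 hpL
  · have := le_normalizer_map (H := B) L.subtype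
    rwa [hJtop, ← MonoidHom.range_eq_map, range_subtype] at this

/-- The local-to-global principle: if `G` splits over `N` at all primes of `σ`, then `N` has a supplement
meeting `N` in a subgroup of order prime to `σ`. -/
theorem exists_supplement_of_splitsAt (n : ℕ) : ∀ (σ : Finset ℕ), (∀ p ∈ σ, p.Prime) →
    ∀ (G : Type v) [Group G] [Finite G] (N : Subgroup G) [N.Normal], Nat.card N = n →
    HasAbelianSylows N → (∀ p ∈ σ, SplitsAt p N) →
    ∃ L : Subgroup G, L ⊔ N = ⊤ ∧ ∀ p ∈ σ, ¬ p ∣ Nat.card (L ⊓ N : Subgroup G) := by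
  induction n using Nat.strong_induction_on with | _ n ih => ?_
  intro σ
  induction σ using Finset.induction_on with
  | empty => exact fun _ G _ _ N _ _ _ _ => ⟨⊤, top_sup_eq _, by simp⟩
  | insert p σ hpσ ihσ => ?_
  intro hprime G _ _ N _ hn hab hsplit
  obtain ⟨L₀, hL₀⟩ := ihσ (fun q hq => hprime q (Finset.mem_insert_of_mem hq)) G N hn hab
    fun q hq => hsplit q (Finset.mem_insert_of_mem hq)
  obtain ⟨L, hLmin⟩ := (Set.toFinite {L : Subgroup G | L ⊔ N = ⊤ ∧
    ∀ q ∈ σ, ¬ q ∣ Nat.card (L ⊓ N : Subgroup G)}).exists_minimal ⟨L₀, hL₀⟩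
  obtain ⟨hL, hLσ⟩ := hLmin.prop
  have hmin : ∀ L' ≤ L, L' ⊔ N = ⊤ → L' = L := fun L' hle h =>
    hLmin.eq_of_le ⟨h, fun q hq hd => hLσ q hq
      (hd.trans (card_dvd_of_le (inf_le_inf_right N hle)))⟩ hle
  by_cases hpL : p ∣ Nat.card (L ⊓ N : Subgroup G)
  swap
  · refine ⟨L, hL, fun q hq => ?_⟩
    rcases Finset.mem_insert.mp hq with rfl | hq
    exacts [hpL, hLσ q hq]
  have hp : Fact p.Prime := ⟨hprime p (Finset.mem_insert_self p σ)⟩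
  obtain ⟨A, hAp, hAN, hA1, hLΓ⟩ := normalizer_sylow_of_minimal hL hmin hpL
  set Γ := normalizer (A : Set G) with hΓ
  have hΓN : Γ ⊔ N = ⊤ := top_le_iff.mp (hL ▸ sup_le_sup_right hLΓ N)
  have hAΓ : A ≤ Γ := le_normalizer
  have hA' : (A.subgroupOf Γ).Normal := normal_in_normalizer
  -- A Sylow `p`-subgroup of `N` containing `A` centralizes `A`.
  have hΓi : ¬ p ∣ Γ.index := by
    obtain ⟨P, hAP⟩ := (hAp.comap_subtype (K := N)).exists_le_sylow
    have := hab.isMulCommutative hp.out P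
    have hPΓ : (P : Subgroup N) ≤ Γ.subgroupOf N := by
      intro x hx
      refine centralizer_le_normalizer (A : Set G) (mem_centralizer_iff.mpr fun a ha => ?_)
      exact congrArg Subtype.val
        (setLike_mul_comm (s := (P : Subgroup N)) (a := ⟨a, hAN ha⟩) (b := x) (hAP ha) hx)
    have h1 : Γ.index = Γ.relIndex N := by
      have e1 := relIndex_mul_index (inf_le_left : Γ ⊓ N ≤ Γ)
      have e2 := relIndex_mul_index (inf_le_right : Γ ⊓ N ≤ N)
      rw [inf_relIndex_left, ← relIndex_sup_right Γ N, hΓN, relIndex_top_right, ← e2,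
        inf_relIndex_right, mul_comm] at e1
      exact Nat.eq_of_mul_eq_mul_right (Nat.pos_of_ne_zero N.index_ne_zero_of_finite) e1
    rw [h1]
    exact fun h => P.not_dvd_index (h.trans (index_dvd_of_le hPΓ))
  obtain ⟨Y, hYN, ⟨k, hk⟩, hAY, hYp⟩ := exists_smaller_supplement (p := p) (N.subgroupOf Γ)
    (A.subgroupOf Γ) (hab.subgroupOf Γ) hAp.comap_subtype (comap_mono hAN)
    (fun h => hA1 (by rwa [subgroupOf_eq_bot, disjoint_iff, inf_of_le_left hAΓ] at h))
    ((hsplit p (Finset.mem_insert_self p σ)).subgroupOf hΓN hΓi)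
  obtain ⟨M, hMN, hMσ⟩ := ih (Nat.card ((N.subgroupOf Γ).subgroupOf Y)) (by
      have h1 : Nat.card ((N.subgroupOf Γ).subgroupOf Y) =
          Nat.card ((Y ⊓ N.subgroupOf Γ : Subgroup Γ).map Γ.subtype) := by
        rw [card_map_of_injective Γ.subtype_injective, inf_comm, ← subgroupOf_map_subtype,
          card_map_of_injective Y.subtype_injective]
      rw [h1, ← hn]
      refine lt_of_le_of_ne (card_le_of_le (map_le_iff_le_comap.mpr inf_le_right)) fun h => hAY ?_
      have h2 := eq_of_le_of_card_ge (map_le_iff_le_comap.mpr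
        (inf_le_right : Y ⊓ N.subgroupOf Γ ≤ N.subgroupOf Γ)) h.ge
      intro a ha
      obtain ⟨y, hy, hya⟩ : (a : G) ∈ (Y ⊓ N.subgroupOf Γ : Subgroup Γ).map Γ.subtype := by
        rw [h2]; exact hAN ha
      rw [← Γ.subtype_injective hya]
      exact hy.1)
    (insert p σ) hprime Y ((N.subgroupOf Γ).subgroupOf Y) rfl
    ((hab.subgroupOf Γ).subgroupOf Y) (by
      intro q hq
      by_cases hqp : q = p
      · rw [hqp]
        exact hYp
      have hqσ := (Finset.mem_insert.mp hq).resolve_left hqp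
      have : Fact q.Prime := ⟨hprime q hq⟩
      -- The splitting of `G` at `q` need not descend to `Γ`; the Sylow `q`-subgroups of `L ≤ Γ` supply
      -- one.
      have h1 : SplitsAt q (N.subgroupOf Γ) := by
        refine splitsAt_of_subgroup _ (L.subgroupOf Γ) ?_ ?_
        · rw [← card_map_subtype_inf, subgroupOf_map_subtype, inf_of_le_left hLΓ]
          exact hLσ q hqσ
        · rw [subgroupOf_sup_eq_top hL hLΓ, index_top]
          exact (hprime q hq).not_dvd_one
      refine h1.subgroupOf hYN ?_
      rw [hk]
      exact fun h => hqp ((Nat.prime_dvd_prime_iff_eq (hprime q hq) hp.out).mp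
        ((hprime q hq).dvd_of_dvd_pow h)))
  refine ⟨(M.map Y.subtype).map Γ.subtype, map_subtype_sup_eq_top_of_subgroupOf hΓN
    (map_subtype_sup_eq_top_of_subgroupOf hYN hMN), fun q hq => ?_⟩
  rw [card_map_subtype_inf, card_map_subtype_inf]
  exact hMσ q hq

/-! ### Groups with abelian Sylow subgroups -/

theorem mainTheorem1 (N : Type u) [Group N] [Finite N]
    (hN : ∀ (p : ℕ) [Fact p.Prime] (P : Sylow p N), IsMulCommutative P) :
    GaschuetzTheoremHoldsFor.{u, v} N := by
  intro G _ _ i H hi hnormal hNH hcop hcompl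
  obtain ⟨K, hK⟩ := hcompl
  have hab : HasAbelianSylows i.range := by
    intro p hp Q hQ hQp
    have := Fact.mk hp
    obtain ⟨P, hP⟩ := (hQp.comap_of_injective i hi).exists_le_sylow
    have := hN p P
    refine .of_setLike_mul_comm fun a ha b hb => ?_
    obtain ⟨x, rfl⟩ := hQ ha
    obtain ⟨y, rfl⟩ := hQ hb
    rw [← map_mul, ← map_mul, setLike_mul_comm (s := (P : Subgroup N)) (hP ha) (hP hb)]
  have hcard : Nat.card i.range = Nat.card N := (Nat.card_congr (i.ofInjective hi).toEquiv).symm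
  have hsplit : ∀ p ∈ (Nat.card N).primeFactors, SplitsAt p i.range := by
    intro p hp
    have hp' := Nat.prime_of_mem_primeFactors hp
    have := Fact.mk hp'
    refine splitsAt_of_subgroup _ (K.map H.subtype) ?_ ?_
    · rw [card_map_subtype_inf, inf_comm, hK.disjoint.eq_bot, card_bot]
      exact hp'.not_dvd_one
    · have h1 : K.map H.subtype ⊔ i.range = H := by
        have h := congrArg (map H.subtype) hK.sup_eq_top
        rwa [Subgroup.map_sup, subgroupOf_map_subtype, inf_of_le_left hNH,
          ← MonoidHom.range_eq_map, range_subtype, sup_comm] at h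
      rw [h1]
      exact fun h => hp'.one_lt.ne' (Nat.eq_one_of_dvd_coprimes hcop
        (Nat.dvd_of_mem_primeFactors hp) h)
  obtain ⟨L, hL, hLp⟩ := exists_supplement_of_splitsAt _ (Nat.card N).primeFactors
    (fun p hp => Nat.prime_of_mem_primeFactors hp) G i.range rfl hab hsplit
  have hbot : L ⊓ i.range = ⊥ := by
    rw [← card_eq_one]
    by_contra h
    obtain ⟨p, hp, hpd⟩ := Nat.exists_prime_and_dvd h
    exact hLp p (Nat.mem_primeFactors.mpr ⟨hp, hcard ▸ hpd.trans (card_dvd_of_le inf_le_right),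
      Nat.card_pos.ne'⟩) hpd
  exact ⟨L, isComplement'_of_disjoint_and_mul_eq_univ (disjoint_iff.mpr (by rwa [inf_comm]))
    (by rw [← normal_mul, sup_comm, hL, coe_top])⟩
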